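/- Let $S$ be a finite nonempty set and let $p : 2^S \to \mathbb{Z} \cup \{-\infty\}$ be a supermodular set function with $p(\emptyset)=0$ and $p(S)$ finite, i.e. $p(X)+p(Y)\le p(X\cap Y)+p(X\cup Y)$ whenever $p(X),p(Y)>-\infty$. Let $$B=\{x\in\mathbb{R}^S : \textstyle\sum_{s\in S}x(s)=p(S),\ \sum_{s\in Z}x(s)\ge p(Z)\ \text{for all } Z\subseteq S\}$$ be the integral base-polyhedron described by $p$, and let $\overset{\ldotp}{B}=B\cap\mathbb{Z}^S$. For $\pi\in\mathbb{Z}^S$ let $$\hat p(\pi)=p(I_n)\pi(s_n)+\sum_{j=1}^{n-1}p(I_j)\,[\pi(s_j)-\pi(s_{j+1})]$$ (with $0\cdot(-\infty)=0$) be the linear (Lovász) extension, where $S=\{s_1,\dots,s_n\}$ is indexed so that $\pi(s_1)\ge\cdots\ge\pi(s_n)$ and $I_j=\{s_1,\dots,s_j\}$. An integral vector $\hat\pi$ is called dual optimal if it attains the maximum on the right-hand side of the square-sum min-max formula $$\min\Big\{\sum_{s\in S}m(s)^2 : m\in\overset{\ldotp}{B}\Big\}=\max\Big\{\hat p(\pi)-\sum_{s\in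 S}\Big\lfloor\frac{\pi(s)}2\Big\rfloor\Big\lceil\frac{\pi(s)}2\Big\rceil : \pi\in\mathbb{Z}^S\Big\}.$$ An element $m\in\overset{\ldotp}{B}$ is dec-min if, for every $y\in\overset{\ldotp}{B}$, the vector of components of $m$ in decreasing order is lexicographically smaller than or equal to that of $y$; let $\mathrm{dm}(\overset{\ldotp}{B})$ be the set of dec-min elements. Then for every dual optimal $\hat\pi$ we have $\mathrm{dm}(\overset{\ldotp}{B})=T(\hat\pi)\cap \overset{\ldotp}{B}{}^{\circ}(\hat\pi)$, where $$T(\hat\pi)=\{m\in\mathbb{Z}^S : m(s)\in\{\lfloor\hat\pi(s)/2\rfloor,\lceil\hat\pi(s)/2\rceil\}\ \text{for all } s\in S\},$$ $$\overset{\ldotp}{B}{}^{\circ}(\hat\pi)=\Big\{m\in\overset{\ldotp}{B} : \sum_{s\in S}\hat\pi(s)m(s)\le\sum_{s\in S}\hat\pi(s)z(s)\ \text{for all } z\in\overset{\ldotp}{B}\Big\}.$$ Moreover, $\mathrm{dm}(\overset{\ldotp}{B})$ is a matroidal M-convex set, that is, there are a matroid on $S$ with rank function $r$ and a vector $\Delta\in\mathbb{Z}^S$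 such that $\mathrm{dm}(\overset{\ldotp}{B})$ is the set of integral members of $\Delta+\{x\in\mathbb{R}^S : \sum_{s\in S}x(s)=r(S),\ \sum_{s\in Z}x(s)\le r(Z)\ \text{for all } Z\subseteq S\}$. -/

import Mathlib

namespace DecMin

variable {S : Type*} [Fintype S]

/-! ### Rearranging the components of an integral vector in decreasing order -/

/-- An indexing `s_0, …, s_{n-1}` of the elements of `S` (with `n = |S|`) such that
`x s_0 ≥ x s_1 ≥ ⋯ ≥ x s_{n-1}`. -/
noncomputable def descEnum (x : S → ℤ) : Fin (Fintype.card S) ≃ S :=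
  (Tuple.sort (fun i => OrderDual.toDual (x ((Fintype.equivFin S).symm i)))).trans
    (Fintype.equivFin S).symm

theorem antitone_descEnum (x : S → ℤ) : Antitone (fun i => x (descEnum x i)) :=
  fun _ _ hij =>
    Tuple.monotone_sort (fun i => OrderDual.toDual (x ((Fintype.equivFin S).symm i))) hij

/-- The vector `x↓`: the components of `x` in decreasing order. -/
noncomputable def sortDesc (x : S → ℤ) : Fin (Fintype.card S) → ℤ :=
  fun i => x (descEnum x i)

/-- `x` and `y` are value-equivalent. -/
def ValueEquivalent (x y : S → ℤ) : Prop :=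
  sortDesc x = sortDesc y

/-- `x` is decreasingly smaller than `y`: at the first position where `x↓` and `y↓` differ,
`x↓` is smaller. -/
def DecSmaller (x y : S → ℤ) : Prop :=
  ∃ j, (∀ i < j, sortDesc x i = sortDesc y i) ∧ sortDesc x j < sortDesc y j

/-- The set of decreasingly minimal elements of a set `Q` of integral vectors. -/
def decMinElements (Q : Set (S → ℤ)) : Set (S → ℤ) :=
  {x | x ∈ Q ∧ ∀ y ∈ Q, DecSmaller x y ∨ ValueEquivalent x y}

/-! ### Base-polyhedra and their integral members -/

/-- The set of integral members of a set `B` of real vectors. -/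
def integralMembers (B : Set (S → ℝ)) : Set (S → ℤ) :=
  {m | (fun s => (m s : ℝ)) ∈ B}

/-- `p` is (fully) supermodular, where the value `⊥` stands for `-∞`. Since `⊥` is absorbing for
addition, the inequality is a condition only on those pairs `X`, `Y` at which `p` is finite. -/
def Supermodular [DecidableEq S] (p : Finset S → WithBot ℤ) : Prop :=
  ∀ X Y : Finset S, p X + p Y ≤ p (X ∩ Y) + p (X ∪ Y)

/-- The base-polyhedron `{x ∈ ℝ^S : x(S) = p(S), x(Z) ≥ p(Z) for every Z ⊆ S}`. -/
def basePolyhedron (p : Finset S → WithBot ℤ) : Set (S → ℝ) :=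
  {x | (p Finset.univ).map (Int.cast : ℤ → ℝ) = ((∑ s, x s : ℝ) : WithBot ℝ) ∧
    ∀ Z : Finset S, (p Z).map (Int.cast : ℤ → ℝ) ≤ ((∑ s ∈ Z, x s : ℝ) : WithBot ℝ)}

/-! ### The linear extension and the dual problem -/

/-- The set of the first `j` elements of `S` in the indexing `e`. -/
def firstElements (e : Fin (Fintype.card S) ≃ S) (j : ℕ) : Finset S :=
  Finset.univ.filter (fun s => (e.symm s : ℕ) < j)

/-- The expression `p(I_n) π(s_n) + ∑_{j=1}^{n-1} p(I_j) (π(s_j) - π(s_{j+1}))` for an indexing `e`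
of the elements of `S`; the product `0 * ⊥` is `0` in `WithBot ℤ`. -/
def linearExtensionAlong [Nonempty S] (p : Finset S → WithBot ℤ) (π : S → ℤ)
    (e : Fin (Fintype.card S) ≃ S) : WithBot ℤ :=
  p (firstElements e (Fintype.card S)) *
      ((π (e ⟨Fintype.card S - 1, Nat.sub_lt Fintype.card_pos Nat.one_pos⟩) : ℤ) : WithBot ℤ) +
    ∑ j : Fin (Fintype.card S - 1),
      p (firstElements e (j + 1)) *
        ((π (e ⟨j, by omega⟩) - π (e ⟨j + 1, by omega⟩) : ℤ) : WithBot ℤ)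

/-- The linear extension (Lovász extension) of `p`, on integral vectors. -/
noncomputable def linearExtension [Nonempty S] (p : Finset S → WithBot ℤ) (π : S → ℤ) :
    WithBot ℤ :=
  linearExtensionAlong p π (descEnum π)

/-- The linear extension may be computed with any indexing along which `π` is decreasing. -/
theorem linearExtension_eq_along [Nonempty S] (p : Finset S → WithBot ℤ) (π : S → ℤ)
    (e : Fin (Fintype.card S) ≃ S) (he : Antitone (fun i => π (e i))) :
    linearExtension p π = linearExtensionAlong p π e := by
  set d := descEnum π with hd
  have hdm : Antitone (fun i => π (d i)) := antitone_descEnum π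
  have key : (fun i => π (d i)) = (fun i => π (e i)) := by
    have h1 := Tuple.unique_monotone
      (f := fun i => OrderDual.toDual (π (d i))) (σ := Equiv.refl _) (τ := e.trans d.symm)
      (fun _ _ h => hdm h) (fun a b h => by simpa using he h)
    funext i
    have h2 := congrFun h1 i
    simpa using h2
  have val : ∀ i, π (d i) = π (e i) := fun i => congrFun key i
  have first_eq : ∀ (c : Fin (Fintype.card S) ≃ S), Antitone (fun i => π (c i)) →
      ∀ (j : ℕ) (h0 : j < Fintype.card S) (h1 : j + 1 < Fintype.card S),
      π (c ⟨j, h0⟩) ≠ π (c ⟨j + 1, h1⟩) →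
      firstElements c (j + 1) = Finset.univ.filter (fun s => π (c ⟨j, h0⟩) ≤ π s) := by
    intro c hc j h0 h1 hne
    ext s
    simp only [firstElements, Finset.mem_filter, Finset.mem_univ, true_and]
    constructor
    · intro h
      have := hc (show c.symm s ≤ ⟨j, h0⟩ from Nat.lt_succ_iff.mp h)
      simpa using this
    · intro h
      by_contra hcon
      have h2 := hc (show (⟨j + 1, h1⟩ : Fin _) ≤ c.symm s from not_lt.mp hcon)
      have h3 := hc (show (⟨j, h0⟩ : Fin _) ≤ ⟨j + 1, h1⟩ from Nat.le_succ j)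
      simp only [Equiv.apply_symm_apply] at h2 h3
      exact hne (le_antisymm (h.trans h2) h3)
  have hall : ∀ c : Fin (Fintype.card S) ≃ S,
      firstElements c (Fintype.card S) = Finset.univ := by
    intro c
    ext s
    simp [firstElements]
  unfold linearExtension linearExtensionAlong
  rw [← hd, hall d, hall e, val]
  congr 1
  refine Finset.sum_congr rfl fun j _ => ?_
  rw [val, val]
  by_cases hj : π (e ⟨j, by omega⟩) = π (e ⟨j + 1, by omega⟩)
  · simp [hj]
  · rw [first_eq e he j (by omega) (by omega) hj,
      first_eq d hdm j (by omega) (by omega) (by rw [val, val]; exact hj), val]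

/-- The dual objective `p̂(π) - ∑_{s ∈ S} ⌊π(s)/2⌋ ⌈π(s)/2⌉`. -/
noncomputable def dualObjective [Nonempty S] (p : Finset S → WithBot ℤ) (π : S → ℤ) : WithBot ℤ :=
  linearExtension p π + ((-∑ s, ⌊(π s : ℝ) / 2⌋ * ⌈(π s : ℝ) / 2⌉ : ℤ) : WithBot ℤ)

/-- `π` is a dual optimal solution: it maximizes the dual objective over `ℤ^S`. -/
def IsDualOptimal [Nonempty S] (p : Finset S → WithBot ℤ) (π : S → ℤ) : Prop :=
  ∀ τ : S → ℤ, dualObjective p τ ≤ dualObjective p π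

/-! ### The two sets in the representation -/

/-- The integral vectors `m` with `m(s) ∈ {⌊π(s)/2⌋, ⌈π(s)/2⌉}` for all `s`. -/
def halfBox (π : S → ℤ) : Set (S → ℤ) :=
  {m | ∀ s, m s = ⌊(π s : ℝ) / 2⌋ ∨ m s = ⌈(π s : ℝ) / 2⌉}

/-- The minimum `π`-weight elements of `Q`. -/
def minWeightElements (Q : Set (S → ℤ)) (π : S → ℤ) : Set (S → ℤ) :=
  {m | m ∈ Q ∧ ∀ z ∈ Q, ∑ s, π s * m s ≤ ∑ s, π s * z s}

/-! ### Matroidal M-convex sets -/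

/-- The base-polyhedron `{x : x(S) = r(S), x(Z) ≤ r(Z) for every Z ⊆ S}` of a matroid `M` on `S`
with rank function `r`. -/
def matroidBasePolyhedron (M : Matroid S) : Set (S → ℝ) :=
  {x | ∑ s, x s = ((M.eRk Set.univ).toNat : ℝ) ∧
    ∀ Z : Finset S, ∑ s ∈ Z, x s ≤ ((M.eRk (Z : Set S)).toNat : ℝ)}

/-- A matroidal M-convex set: the set of integral members of a matroid base-polyhedron
translated by an integral vector. -/
def IsMatroidalMConvex (D : Set (S → ℤ)) : Prop :=
  ∃ (M : Matroid S) (Δ : S → ℤ), M.E = Set.univ ∧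
    D = integralMembers ((fun x s => x s + (Δ s : ℝ)) '' matroidBasePolyhedron M)

end DecMin

namespace DecMin

variable {S : Type*} [Fintype S]

/-! ### Integral members of a base-polyhedron -/

/-! Everything reduces to the absence of a 1-tightening step, a base m + χ_s - χ_t with m(t) ≥ m(s)
+ 2. Tight sets are closed under ∩ and ∪, so without such steps the tight hulls of upper level sets
form a chain C(β) of tight sets separating the values of m up to an error of one
(`NoTightening.exists_chain`).

The chain has two uses. It shows that m minimizes every excess Σ max(m(s) - β, 0) among bases, hence
is dec-min. It also yields an odd-valued π with the C(β) as level sets, which attains equality in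
p̂(π) - Σ⌊π/2⌋⌈π/2⌉ ≤ πm - Σ⌊π/2⌋⌈π/2⌉ ≤ Σm². Equality in the two inequalities means minimum weight
and membership in the box, and this gives the representation for every dual optimum.

So all dec-min elements lie in one unit box. Comparing two of them on a tight set gives base
exchange (`decMinElements_exchange`), and their indicators are the bases of a matroid. -/

theorem map_intCast_le_iff (a : WithBot ℤ) (k : ℤ) :
    a.map (Int.cast : ℤ → ℝ) ≤ ((k : ℝ) : WithBot ℝ) ↔ a ≤ (k : WithBot ℤ) := by
  cases a with
  | bot => simp
  | coe a => simp [WithBot.map_coe, WithBot.coe_le_coe]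

theorem map_intCast_eq_iff (a : WithBot ℤ) (k : ℤ) :
    a.map (Int.cast : ℤ → ℝ) = ((k : ℝ) : WithBot ℝ) ↔ a = (k : WithBot ℤ) := by
  cases a with
  | bot => simp
  | coe a => simp only [WithBot.map_coe, WithBot.coe_inj, Int.cast_inj]

/-- The integral members of the base-polyhedron of `p`. -/
abbrev integralBases (p : Finset S → WithBot ℤ) : Set (S → ℤ) :=
  integralMembers (basePolyhedron p)

theorem mem_integralBases {p : Finset S → WithBot ℤ} {m : S → ℤ} :
    m ∈ integralBases p ↔ p Finset.univ = ((∑ s, m s : ℤ) : WithBot ℤ) ∧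
      ∀ Z : Finset S, p Z ≤ ((∑ s ∈ Z, m s : ℤ) : WithBot ℤ) := by
  simp only [integralMembers, basePolyhedron, Set.mem_ofPred_eq, ← Int.cast_sum,
    map_intCast_le_iff, map_intCast_eq_iff]

/-- `Z` is tight for `m`. -/
def Tight (p : Finset S → WithBot ℤ) (m : S → ℤ) (Z : Finset S) : Prop :=
  p Z = ((∑ s ∈ Z, m s : ℤ) : WithBot ℤ)

section Tight

variable [DecidableEq S] {p : Finset S → WithBot ℤ} {m : S → ℤ}

/-- Supermodularity and the lower bounds squeeze m(X) + m(Y) = m(X ∩ Y) + m(X ∪ Y), forcing equality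
in both bounds; finiteness of p at X and Y passes to X ∩ Y and X ∪ Y. -/
theorem Tight.inter_union {S : Type*} [DecidableEq S] {p : Finset S → WithBot ℤ} {m : S → ℤ}
    (hp : Supermodular p)
    (hm : ∀ Z : Finset S, p Z ≤ ((∑ s ∈ Z, m s : ℤ) : WithBot ℤ)) {X Y : Finset S}
    (hX : Tight p m X) (hY : Tight p m Y) : Tight p m (X ∩ Y) ∧ Tight p m (X ∪ Y) := by
  have h := hp X Y
  have hi := hm (X ∩ Y)
  have hu := hm (X ∪ Y)
  have hs := Finset.sum_union_inter (s₁ := X) (s₂ := Y) (f := m)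
  unfold Tight at *
  rw [hX, hY, ← WithBot.coe_add] at h
  generalize p (X ∩ Y) = a at *
  generalize p (X ∪ Y) = b at *
  cases a with
  | bot => exact absurd (le_bot_iff.mp (h.trans (by simp))) WithBot.coe_ne_bot
  | coe a =>
    cases b with
    | bot => exact absurd (le_bot_iff.mp (h.trans (by simp))) WithBot.coe_ne_bot
    | coe b =>
      rw [← WithBot.coe_add, WithBot.coe_le_coe] at h
      rw [WithBot.coe_le_coe] at hi hu
      rw [WithBot.coe_inj, WithBot.coe_inj]
      constructor <;> linarith

/-- Every supermodular function is the lower bound of some integral base. -/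
theorem integralBases_nonempty (hp : Supermodular p) (h0 : p ∅ = 0)
    (huniv : p Finset.univ ≠ ⊥) : (integralBases p).Nonempty := by
  obtain ⟨c, hc⟩ := WithBot.ne_bot_iff_exists.mp huniv
  set U : Set (S → ℤ) := {x | ∀ Z : Finset S, p Z ≤ ((∑ s ∈ Z, x s : ℤ) : WithBot ℤ)}
  have hUne : U.Nonempty := by
    -- A constant vector dominating every |p(Z)| works, since a nonempty Z contributes it at least
    -- once.
    refine ⟨fun _ => ∑ Z : Finset S, |(p Z).unbotD 0|, fun Z => ?_⟩
    rcases Z.eq_empty_or_nonempty with rfl | hZ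
    · simp [h0]
    · have hK : |(p Z).unbotD 0| ≤ ∑ Z : Finset S, |(p Z).unbotD 0| :=
        Finset.single_le_sum (f := fun Z : Finset S => |(p Z).unbotD 0|)
          (fun _ _ => abs_nonneg _) (Finset.mem_univ Z)
      generalize hq : p Z = a at *
      cases a with
      | bot => exact bot_le
      | coe a =>
        rw [WithBot.coe_le_coe, Finset.sum_const, nsmul_eq_mul]
        rw [WithBot.unbotD_coe] at hK
        have h1 : (1 : ℤ) ≤ Z.card := by exact_mod_cast hZ.card_pos
        nlinarith [le_abs_self a, abs_nonneg a]
  have hlow : ∀ x ∈ U, c ≤ ∑ s, x s := fun x hx => by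
    have := hx Finset.univ
    rwa [← hc, WithBot.coe_le_coe] at this
  obtain ⟨x, hx, hmin⟩ : ∃ x ∈ U, ∀ y ∈ U, (∑ s, x s - c).toNat ≤ (∑ s, y s - c).toNat := by
    obtain ⟨x, hx, h⟩ := WellFounded.has_min
      (InvImage.wf (fun x : S → ℤ => (∑ s, x s - c).toNat) wellFounded_lt) U hUne
    exact ⟨x, hx, fun y hy => not_lt.mp (h y hy)⟩
  -- By minimality of the total no component can be lowered, so each t lies in a tight set; the
  -- union of these is all of S.
  have hcover : ∀ t : S, ∃ Z, Tight p x Z ∧ t ∈ Z := by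
    intro t
    by_contra hcon
    push Not at hcon
    have hsum : ∀ Z : Finset S, ∑ s ∈ Z, (x s - if s = t then 1 else 0) =
        ∑ s ∈ Z, x s - if t ∈ Z then 1 else 0 := by
      intro Z
      rw [Finset.sum_sub_distrib, Finset.sum_ite_eq']
    have hy : (fun s => x s - if s = t then 1 else 0) ∈ U := by
      intro Z
      rw [hsum]
      split_ifs with ht
      · have h1 : p Z ≠ _ := fun h => hcon Z h ht
        have h2 := lt_of_le_of_ne (hx Z) h1
        generalize p Z = a at *
        cases a with
        | bot => exact bot_le
        | coe a =>
          rw [WithBot.coe_lt_coe] at h2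
          rw [WithBot.coe_le_coe]
          omega
      · simpa using hx Z
    have h1 := hmin _ hy
    have h2 := hlow _ hy
    rw [hsum] at h1 h2
    simp only [Finset.mem_univ, if_true] at h1 h2
    omega
  choose Z hZ htZ using hcover
  have hT : Tight p x (Finset.univ.sup Z) :=
    Finset.sup_induction (p := Tight p x) (by simp [Tight, h0])
      (fun X hX Y hY => (Tight.inter_union hp hx hX hY).2) (fun t _ => hZ t)
  have : Finset.univ.sup Z = Finset.univ := by
    refine Finset.eq_univ_of_forall fun t => ?_
    exact (Finset.le_sup (f := Z) (Finset.mem_univ t)) (htZ t)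
  rw [this] at hT
  exact ⟨x, mem_integralBases.mpr ⟨hT, hx⟩⟩

/-- The vector `m + χ_s - χ_t`. -/
def shift {S : Type*} [DecidableEq S] (m : S → ℤ) (s t : S) : S → ℤ :=
  fun u => m u + (if u = s then 1 else 0) - (if u = t then 1 else 0)

theorem sum_shift {S : Type*} [DecidableEq S] (m : S → ℤ) (s t : S) (Z : Finset S) :
    ∑ u ∈ Z, shift m s t u = ∑ u ∈ Z, m u + (if s ∈ Z then 1 else 0) - if t ∈ Z then 1 else 0 := by
  simp only [shift, Finset.sum_sub_distrib, Finset.sum_add_distrib, Finset.sum_ite_eq']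

theorem sum_comp_shift (m : S → ℤ) {s t : S} (hst : s ≠ t) (f : ℤ → ℤ) :
    ∑ u, f (shift m s t u) = ∑ u, f (m u) + (f (m s + 1) - f (m s)) + (f (m t - 1) - f (m t)) := by
  have h : ∀ u, f (shift m s t u) = f (m u) + (if u = s then f (m s + 1) - f (m s) else 0) +
      (if u = t then f (m t - 1) - f (m t) else 0) := by
    intro u
    unfold shift
    by_cases h1 : u = s
    · subst h1; simp [hst]
    · by_cases h2 : u = t
      · subst h2; simp [h1]
      · simp [h1, h2]
  simp only [h, Finset.sum_add_distrib, Finset.sum_ite_eq', Finset.mem_univ, if_true]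

/-- Only sets containing t but not s lose value, and exactly one; none of them is tight, so by
integrality each has that much slack. -/
theorem shift_mem_integralBases (hm : m ∈ integralBases p) {s t : S}
    (h : ∀ Z, Tight p m Z → t ∈ Z → s ∈ Z) : shift m s t ∈ integralBases p := by
  rw [mem_integralBases] at hm ⊢
  refine ⟨by rw [sum_shift]; simpa using hm.1, fun Z => ?_⟩
  have hZ := hm.2 Z
  rw [sum_shift]
  by_cases ht : t ∈ Z
  · by_cases hs : s ∈ Z
    · simpa [ht, hs] using hZ
    · have h2 := lt_of_le_of_ne hZ fun hT => hs (h Z hT ht)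
      generalize p Z = a at *
      cases a with
      | bot => exact bot_le
      | coe a =>
        rw [WithBot.coe_lt_coe] at h2
        rw [WithBot.coe_le_coe]
        simp only [ht, hs, if_true, if_false]
        omega
  · refine hZ.trans (WithBot.coe_le_coe.mpr ?_)
    rw [if_neg ht]
    split_ifs <;> omega

open Classical in
/-- The smallest tight set containing `t`. -/
noncomputable def tightHull (p : Finset S → WithBot ℤ) (m : S → ℤ) (t : S) : Finset S :=
  (Finset.univ.filter fun Z => Tight p m Z ∧ t ∈ Z).inf id

theorem tight_tightHull (hp : Supermodular p) (hm : m ∈ integralBases p) (t : S) :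
    Tight p m (tightHull p m t) := by
  rw [mem_integralBases] at hm
  classical
  refine Finset.inf_induction (p := Tight p m) hm.1
    (fun X hX Y hY => (Tight.inter_union hp hm.2 hX hY).1) fun Z hZ => ?_
  exact (Finset.mem_filter.mp hZ).2.1

theorem mem_tightHull {s t : S} : s ∈ tightHull p m t ↔ ∀ Z, Tight p m Z → t ∈ Z → s ∈ Z := by
  rw [tightHull, ← Finset.singleton_subset_iff, Finset.le_inf_iff]
  simp

theorem self_mem_tightHull (t : S) : t ∈ tightHull p m t :=
  mem_tightHull.mpr fun _ _ h => h

/-- `m` admits no 1-tightening step. -/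
def NoTightening (p : Finset S → WithBot ℤ) (m : S → ℤ) : Prop :=
  ∀ s t, m s + 2 ≤ m t → shift m s t ∉ integralBases p

theorem NoTightening.le_of_mem_tightHull (h : NoTightening p m) (hm : m ∈ integralBases p)
    {s t : S} (hs : s ∈ tightHull p m t) : m t ≤ m s + 1 := by
  by_contra hcon
  exact h s t (by omega) (shift_mem_integralBases hm (mem_tightHull.mp hs))

/-- A base without 1-tightening steps has a chain of tight sets that separates its level sets. -/
theorem NoTightening.exists_chain (h : NoTightening p m) (hp : Supermodular p) (h0 : p ∅ = 0)
    (hm : m ∈ integralBases p) :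
    ∃ C : ℤ → Finset S, Antitone C ∧ (∀ β, Tight p m (C β)) ∧
      (∀ β s, β ≤ m s → s ∈ C β) ∧ ∀ β, ∀ s ∈ C β, β ≤ m s + 1 := by
  -- C(β) is the union of the tight hulls of all t with m(t) ≥ β. Each hull reaches at most one
  -- below m(t).
  refine ⟨fun β => (Finset.univ.filter fun t => β ≤ m t).sup (tightHull p m), ?_, ?_, ?_, ?_⟩
  · intro β γ hβγ
    refine Finset.sup_mono fun t ht => ?_
    simp only [Finset.mem_filter, Finset.mem_univ, true_and] at ht ⊢
    omega
  · intro β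
    exact Finset.sup_induction (p := Tight p m) (by simp [Tight, h0])
      (fun X hX Y hY => (Tight.inter_union hp (mem_integralBases.mp hm).2 hX hY).2)
      (fun t _ => tight_tightHull hp hm t)
  · intro β s hs
    exact Finset.mem_sup.mpr ⟨s, by simpa using hs, self_mem_tightHull s⟩
  · intro β s hs
    obtain ⟨t, ht, hst⟩ := Finset.mem_sup.mp hs
    simp only [Finset.mem_filter, Finset.mem_univ, true_and] at ht
    have := h.le_of_mem_tightHull hm hst
    omega

end Tight

/-! ### Decreasing minimality and excess over thresholds -/

/-- The total excess of `m` over the threshold `β`. -/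
def excess (m : S → ℤ) (β : ℤ) : ℤ := ∑ s, max (m s - β) 0

theorem sum_comp_sortDesc (f : ℤ → ℤ) (m : S → ℤ) : ∑ i, f (sortDesc m i) = ∑ s, f (m s) :=
  Equiv.sum_comp (descEnum m) fun s => f (m s)

theorem ValueEquivalent.sum_comp_eq {x y : S → ℤ} (h : ValueEquivalent x y) (f : ℤ → ℤ) :
    ∑ s, f (x s) = ∑ s, f (y s) := by
  rw [← sum_comp_sortDesc f x, ← sum_comp_sortDesc f y, h]

theorem DecSmaller.asymm {x y : S → ℤ} (h : DecSmaller x y) : ¬ DecSmaller y x := by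
  rintro ⟨j, hj, hjlt⟩
  obtain ⟨i, hi, hilt⟩ := h
  rcases lt_trichotomy i j with hij | rfl | hij
  · exact hilt.ne' (hj i hij)
  · exact hilt.asymm hjlt
  · exact hjlt.ne' (hi j hij)

/-- Take the first position j where the sorted vectors differ. Were y smaller there, the threshold
y↓(j) would give x the strictly larger excess: earlier positions agree and later ones contribute
nothing for y. -/
theorem decSmaller_or_valueEquivalent_of_excess_le {x y : S → ℤ}
    (h : ∀ β, excess x β ≤ excess y β) : DecSmaller x y ∨ ValueEquivalent x y := by
  by_cases hxy : ValueEquivalent x y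
  · exact Or.inr hxy
  left
  have hne : ∃ i, sortDesc x i ≠ sortDesc y i := by
    by_contra hcon
    push Not at hcon
    exact hxy (funext hcon)
  obtain ⟨j, hj, hmin⟩ := WellFounded.has_min (wellFounded_lt (α := Fin (Fintype.card S)))
    {i | sortDesc x i ≠ sortDesc y i} hne
  have heq : ∀ i < j, sortDesc x i = sortDesc y i := fun i hi => by
    by_contra hcon
    exact hmin i hcon hi
  refine ⟨j, heq, ?_⟩
  by_contra hlt
  have hgt : sortDesc y j < sortDesc x j := lt_of_le_of_ne (not_lt.mp hlt) (Ne.symm hj)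
  refine absurd (h (sortDesc y j)) (not_le.mpr ?_)
  unfold excess
  rw [← sum_comp_sortDesc (fun a => max (a - sortDesc y j) 0) x,
    ← sum_comp_sortDesc (fun a => max (a - sortDesc y j) 0) y]
  refine Finset.sum_lt_sum (fun i _ => ?_) ⟨j, Finset.mem_univ j, ?_⟩
  · rcases lt_or_ge i j with hij | hij
    · rw [heq i hij]
    · have : sortDesc y i ≤ sortDesc y j := antitone_descEnum y hij
      simp only [max_eq_right (sub_nonpos.mpr this)]
      exact le_max_right _ _
  · simp only [sub_self, max_self]
    exact lt_max_of_lt_left (sub_pos.mpr hgt)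

/-! ### Dec-min elements, tightening steps and square-sums -/

section

variable [DecidableEq S] {p : Finset S → WithBot ℤ} {m : S → ℤ}

theorem excess_eq_sum {C : Finset S} {β : ℤ} (hge : ∀ s ∈ C, β ≤ m s)
    (hle : ∀ s ∉ C, m s ≤ β) : excess m β = ∑ s ∈ C, (m s - β) := by
  rw [excess, ← Finset.sum_filter_add_sum_filter_not _ (· ∈ C),
    Finset.sum_eq_zero (s := Finset.univ.filter fun s => s ∉ C), add_zero]
  · simp only [Finset.filter_univ_mem]
    exact Finset.sum_congr rfl fun s hs => max_eq_left (sub_nonneg.mpr (hge s hs))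
  · intro s hs
    exact max_eq_right (sub_nonpos.mpr (hle s (Finset.mem_filter.mp hs).2))

/-- If `C` is tight for `m` and separates the values of `m` at the threshold `β`, then `m` has the
least excess over `β`, and `C` is tight and separating for every base with the same excess. -/
theorem Tight.eq_of_excess_le {C : Finset S} {β : ℤ} (hT : Tight p m C)
    (hge : ∀ s ∈ C, β ≤ m s) (hle : ∀ s ∉ C, m s ≤ β) {y : S → ℤ} (hy : y ∈ integralBases p)
    (hex : excess y β ≤ excess m β) :
    ∑ s ∈ C, y s = ∑ s ∈ C, m s ∧ (∀ s ∈ C, β ≤ y s) ∧ ∀ s ∉ C, y s ≤ β := by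
  have hC : ∑ s ∈ C, m s ≤ ∑ s ∈ C, y s := by
    have := (mem_integralBases.mp hy).2 C
    rwa [hT, WithBot.coe_le_coe] at this
  rw [excess_eq_sum hge hle, Finset.sum_sub_distrib] at hex
  -- g is the termwise loss in y(C) - β|C| ≤ excess of y; the hypotheses leave no room for it, so
  -- every term vanishes.
  set g : S → ℤ := fun s => max (y s - β) 0 - if s ∈ C then y s - β else 0 with hg
  have hg0 : ∀ s, 0 ≤ g s := by
    intro s
    simp only [hg]
    split_ifs <;> omega
  have hsum : ∑ s, g s = excess y β - (∑ s ∈ C, y s - ∑ s ∈ C, β) := by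
    rw [← Finset.sum_sub_distrib]
    simp [hg, excess, Finset.sum_sub_distrib]
  have hpos : 0 ≤ ∑ s, g s := Finset.sum_nonneg fun s _ => hg0 s
  have hzero := (Finset.sum_eq_zero_iff_of_nonneg fun s _ => hg0 s).mp
    (le_antisymm (by linarith) hpos)
  refine ⟨by linarith, fun s hs => ?_, fun s hs => ?_⟩
  · have := hzero s (Finset.mem_univ s)
    simp only [hg, if_pos hs] at this
    omega
  · have := hzero s (Finset.mem_univ s)
    simp only [hg, if_neg hs] at this
    omega

/-- The tight set C(β + 1) holds values ≥ β and leaves out values ≤ β, so it captures the excess of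
m exactly, while for y it only bounds it from below. -/
theorem NoTightening.excess_le (h : NoTightening p m) (hp : Supermodular p) (h0 : p ∅ = 0)
    (hm : m ∈ integralBases p) {y : S → ℤ} (hy : y ∈ integralBases p) (β : ℤ) :
    excess m β ≤ excess y β := by
  obtain ⟨C, -, hT, hsub, hsup⟩ := h.exists_chain hp h0 hm
  have hC : ∑ s ∈ C (β + 1), m s ≤ ∑ s ∈ C (β + 1), y s := by
    have := (mem_integralBases.mp hy).2 (C (β + 1))
    rwa [hT, WithBot.coe_le_coe] at this
  calc excess m β = ∑ s ∈ C (β + 1), (m s - β) := by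
        refine excess_eq_sum (fun s hs => ?_) fun s hs => ?_
        · have := hsup _ s hs
          omega
        · have := mt (hsub (β + 1) s) hs
          omega
    _ ≤ ∑ s ∈ C (β + 1), (y s - β) := by
        rw [Finset.sum_sub_distrib, Finset.sum_sub_distrib]
        linarith
    _ ≤ ∑ s ∈ C (β + 1), max (y s - β) 0 := Finset.sum_le_sum fun s _ => le_max_left _ _
    _ ≤ excess y β :=
        Finset.sum_le_sum_of_subset_of_nonneg (Finset.subset_univ _) fun s _ _ => le_max_right _ _

theorem mem_decMinElements_iff_noTightening (hp : Supermodular p) (h0 : p ∅ = 0)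
    (hm : m ∈ integralBases p) : m ∈ decMinElements (integralBases p) ↔ NoTightening p m := by
  constructor
  · rintro ⟨-, hmin⟩ s t hst hmem
    have hne : s ≠ t := by rintro rfl; omega
    have hsq := sum_comp_shift m hne (fun a => a ^ 2)
    -- A tightening step increases no convex sum, so dec-minimality leaves only value-equivalence;
    -- the strict drop of the square-sum rules that out.
    have hex : ∀ β, excess (shift m s t) β ≤ excess m β := by
      intro β
      have := sum_comp_shift m hne (fun a => max (a - β) 0)
      simp only [excess]
      rw [this]
      omega
    have hVE : ValueEquivalent (shift m s t) m := by
      rcases decSmaller_or_valueEquivalent_of_excess_le hex with h | h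
      · rcases hmin _ hmem with h' | h'
        · exact absurd h h'.asymm
        · exact h'.symm
      · exact h
    have := hVE.sum_comp_eq (fun a => a ^ 2)
    nlinarith
  · intro h
    exact ⟨hm, fun y hy =>
      decSmaller_or_valueEquivalent_of_excess_le fun β => h.excess_le hp h0 hm hy β⟩

theorem noTightening_of_sum_sq_le (h : ∀ y ∈ integralBases p, ∑ s, m s ^ 2 ≤ ∑ s, y s ^ 2) :
    NoTightening p m := by
  intro s t hst hmem
  have hne : s ≠ t := by rintro rfl; omega
  have hsq := sum_comp_shift m hne (fun a => a ^ 2)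
  have := h _ hmem
  nlinarith

theorem exists_sum_sq_min (hp : Supermodular p) (h0 : p ∅ = 0) (huniv : p Finset.univ ≠ ⊥) :
    ∃ m ∈ integralBases p, ∀ y ∈ integralBases p, ∑ s, m s ^ 2 ≤ ∑ s, y s ^ 2 := by
  obtain ⟨m, hm, hmin⟩ := WellFounded.has_min
    (InvImage.wf (fun m : S → ℤ => (∑ s, m s ^ 2).toNat) wellFounded_lt) _
    (integralBases_nonempty hp h0 huniv)
  refine ⟨m, hm, fun y hy => ?_⟩
  have h1 := hmin y hy
  have h2 : 0 ≤ ∑ s, y s ^ 2 := Finset.sum_nonneg fun s _ => sq_nonneg _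
  simp only [InvImage] at h1
  omega

end

/-! ### Halves of integers -/

theorem floor_half (a : ℤ) : ⌊(a : ℝ) / 2⌋ = a / 2 := by
  simpa using Int.floor_div_natCast (a : ℝ) 2

theorem floor_half_add_ceil_half (a : ℤ) : ⌊(a : ℝ) / 2⌋ + ⌈(a : ℝ) / 2⌉ = a := by
  have h : ⌈(a : ℝ) / 2⌉ = -((-a) / 2) := by
    rw [← floor_half, Int.cast_neg, neg_div, Int.floor_neg, neg_neg]
  rw [h, floor_half]
  omega

theorem ceil_half (a : ℤ) : ⌈(a : ℝ) / 2⌉ = a - a / 2 := by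
  have := floor_half_add_ceil_half a
  rw [floor_half] at this
  omega

/-- The difference of the two sides is (k - ⌊a/2⌋)(k - ⌈a/2⌉), and no integer lies strictly between
the two roots. -/
theorem mul_sub_le_sq (a k : ℤ) : a * k - ⌊(a : ℝ) / 2⌋ * ⌈(a : ℝ) / 2⌉ ≤ k ^ 2 := by
  rw [floor_half, ceil_half]
  rcases le_or_gt k (a / 2) with h | h
  · nlinarith [mul_nonneg (sub_nonneg.mpr h) (show 0 ≤ a - a / 2 - k by omega)]
  · nlinarith [mul_nonneg (show 0 ≤ k - a / 2 by omega) (show 0 ≤ k - (a - a / 2) by omega)]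

theorem mul_sub_eq_sq_iff (a k : ℤ) : a * k - ⌊(a : ℝ) / 2⌋ * ⌈(a : ℝ) / 2⌉ = k ^ 2 ↔
    k = ⌊(a : ℝ) / 2⌋ ∨ k = ⌈(a : ℝ) / 2⌉ := by
  rw [← sub_eq_zero (a := k), ← sub_eq_zero (a := k), ← mul_eq_zero, floor_half, ceil_half]
  constructor <;> intro h <;> linear_combination -h

/-- The quadratic conjugate term `∑ ⌊π(s)/2⌋ ⌈π(s)/2⌉` of the dual objective. -/
noncomputable def halfProd (π : S → ℤ) : ℤ := ∑ s, ⌊(π s : ℝ) / 2⌋ * ⌈(π s : ℝ) / 2⌉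

theorem sum_mul_sub_halfProd_le (π m : S → ℤ) :
    ∑ s, π s * m s - halfProd π ≤ ∑ s, m s ^ 2 := by
  rw [halfProd, ← Finset.sum_sub_distrib]
  exact Finset.sum_le_sum fun s _ => mul_sub_le_sq _ _

theorem sum_mul_sub_halfProd_eq_iff (π m : S → ℤ) :
    ∑ s, π s * m s - halfProd π = ∑ s, m s ^ 2 ↔ m ∈ halfBox π := by
  rw [halfProd, ← Finset.sum_sub_distrib,
    Finset.sum_eq_sum_iff_of_le fun s _ => mul_sub_le_sq _ _]
  simp [halfBox, mul_sub_eq_sq_iff]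

/-! ### The linear extension and the weights of bases -/

theorem sum_range_mul_eq_by_parts (a b : ℕ → ℤ) (k : ℕ) :
    ∑ i ∈ Finset.range (k + 1), b i * a i =
      (∑ i ∈ Finset.range (k + 1), a i) * b k +
        ∑ j ∈ Finset.range k, (∑ i ∈ Finset.range (j + 1), a i) * (b j - b (j + 1)) := by
  induction k with
  | zero => simp [mul_comm]
  | succ k ih =>
    rw [Finset.sum_range_succ, ih, Finset.sum_range_succ _ (k + 1),
      Finset.sum_range_succ (fun j => (∑ i ∈ Finset.range (j + 1), a i) * (b j - b (j + 1))) k]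
    ring

theorem sum_firstElements (e : Fin (Fintype.card S) ≃ S) (m : S → ℤ) {j : ℕ}
    (hj : j ≤ Fintype.card S) : ∑ s ∈ firstElements e j, m s =
      ∑ i ∈ Finset.range j, if h : i < Fintype.card S then m (e ⟨i, h⟩) else 0 := by
  symm
  refine Finset.sum_bij (fun i hi => e ⟨i, (Finset.mem_range.mp hi).trans_le hj⟩) ?_ ?_ ?_ ?_
  · intro i hi
    simpa [firstElements] using hi
  · intro i hi i' hi' h
    simpa using h
  · intro s hs
    refine ⟨e.symm s, ?_, by simp⟩
    simpa [firstElements] using hs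
  · intro i hi
    rw [dif_pos]

theorem firstElements_card (e : Fin (Fintype.card S) ≃ S) :
    firstElements e (Fintype.card S) = Finset.univ := by
  ext s
  simp [firstElements]

/-- Abel summation: the weight of m is `linearExtensionAlong` with p replaced by the sums of m, so
the two compare term by term. -/
theorem sum_mul_eq_along [Nonempty S] (π m : S → ℤ) (e : Fin (Fintype.card S) ≃ S) :
    ∑ s, π s * m s = (∑ s, m s) *
        π (e ⟨Fintype.card S - 1, Nat.sub_lt Fintype.card_pos Nat.one_pos⟩) +
      ∑ j : Fin (Fintype.card S - 1), (∑ s ∈ firstElements e (j + 1), m s) *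
        (π (e ⟨j, by omega⟩) - π (e ⟨j + 1, by omega⟩)) := by
  have hcard := Fintype.card_pos (α := S)
  have h := sum_range_mul_eq_by_parts
    (fun i => if h : i < Fintype.card S then m (e ⟨i, h⟩) else 0)
    (fun i => if h : i < Fintype.card S then π (e ⟨i, h⟩) else 0) (Fintype.card S - 1)
  rw [Nat.sub_add_cancel hcard] at h
  have h1 : ∑ s, π s * m s = ∑ i ∈ Finset.range (Fintype.card S),
      (if h : i < Fintype.card S then π (e ⟨i, h⟩) else 0) *
        if h : i < Fintype.card S then m (e ⟨i, h⟩) else 0 := by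
    rw [← firstElements_card e, sum_firstElements e (fun s => π s * m s) le_rfl]
    refine Finset.sum_congr rfl fun i hi => ?_
    simp only [dif_pos (Finset.mem_range.mp hi)]
  rw [h1, h, ← sum_firstElements e m le_rfl, firstElements_card, dif_pos (by omega)]
  congr 1
  rw [Finset.sum_range]
  refine Finset.sum_congr rfl fun j _ => ?_
  rw [sum_firstElements e m (by omega), dif_pos (by omega), dif_pos (by omega)]

section

variable [Nonempty S] {p : Finset S → WithBot ℤ} {m : S → ℤ}

theorem linearExtension_le (hm : m ∈ integralBases p) (π : S → ℤ) :
    linearExtension p π ≤ ((∑ s, π s * m s : ℤ) : WithBot ℤ) := by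
  rw [mem_integralBases] at hm
  rw [linearExtension, linearExtensionAlong, firstElements_card, hm.1,
    sum_mul_eq_along π m (descEnum π), WithBot.coe_add, WithBot.coe_mul,
    WithBot.coe_sum Finset.univ fun j : Fin (Fintype.card S - 1) => _]
  refine add_le_add le_rfl (Finset.sum_le_sum fun j _ => ?_)
  rw [WithBot.coe_mul]
  refine mul_le_mul_of_nonneg_right (hm.2 _) ?_
  refine WithBot.coe_le_coe.mpr (sub_nonneg.mpr (antitone_descEnum π ?_))
  exact Fin.mk_le_mk.mpr (Nat.le_succ _)

/-- Positions where π does not drop have coefficient zero, so only upper level sets of π need to be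
tight. -/
theorem linearExtension_eq_of_tight (hm : m ∈ integralBases p) (π : S → ℤ)
    (hT : ∀ s, Tight p m (Finset.univ.filter fun u => π s ≤ π u)) :
    linearExtension p π = ((∑ s, π s * m s : ℤ) : WithBot ℤ) := by
  rw [mem_integralBases] at hm
  rw [linearExtension, linearExtensionAlong, firstElements_card, hm.1,
    sum_mul_eq_along π m (descEnum π), WithBot.coe_add, WithBot.coe_mul,
    WithBot.coe_sum Finset.univ fun j : Fin (Fintype.card S - 1) => _]
  congr 1
  refine Finset.sum_congr rfl fun j _ => ?_
  rw [WithBot.coe_mul]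
  by_cases hj : π (descEnum π ⟨j, by omega⟩) = π (descEnum π ⟨j + 1, by omega⟩)
  · rw [hj, sub_self, WithBot.coe_zero, mul_zero, mul_zero]
  · have hset : firstElements (descEnum π) (j + 1) =
        Finset.univ.filter fun u => π (descEnum π ⟨j, by omega⟩) ≤ π u := by
      ext u
      simp only [firstElements, Finset.mem_filter, Finset.mem_univ, true_and]
      constructor
      · intro hu
        have := antitone_descEnum π
          (show (descEnum π).symm u ≤ ⟨j, by omega⟩ from Nat.lt_succ_iff.mp hu)
        simpa using this
      · intro hu
        by_contra hcon
        have h2 := antitone_descEnum π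
          (show (⟨j + 1, by omega⟩ : Fin _) ≤ (descEnum π).symm u from not_lt.mp hcon)
        have h3 := antitone_descEnum π
          (show (⟨j, by omega⟩ : Fin (Fintype.card S)) ≤ ⟨j + 1, by omega⟩ from Nat.le_succ j)
        simp only [Equiv.apply_symm_apply] at h2 h3
        exact hj (le_antisymm (hu.trans h2) h3)
    rw [hset, hT]

theorem dualObjective_le (hm : m ∈ integralBases p) (π : S → ℤ) :
    dualObjective p π ≤ ((∑ s, m s ^ 2 : ℤ) : WithBot ℤ) := by
  refine (add_le_add_left (linearExtension_le hm π) _).trans ?_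
  rw [← WithBot.coe_add, WithBot.coe_le_coe, ← sub_eq_add_neg]
  exact sum_mul_sub_halfProd_le π m

/-- Complementary slackness: the two inequalities of weak duality must both be equalities. -/
theorem sum_sq_le_dualObjective_iff (hm : m ∈ integralBases p) (π : S → ℤ) :
    ((∑ s, m s ^ 2 : ℤ) : WithBot ℤ) ≤ dualObjective p π ↔
      m ∈ halfBox π ∧ linearExtension p π = ((∑ s, π s * m s : ℤ) : WithBot ℤ) := by
  have hle := linearExtension_le hm π
  have hbox := sum_mul_sub_halfProd_le π m
  rw [← sum_mul_sub_halfProd_eq_iff, dualObjective]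
  change _ ≤ _ + ((-halfProd π : ℤ) : WithBot ℤ) ↔ _
  generalize linearExtension p π = a at *
  cases a with
  | bot => simp only [WithBot.bot_add, le_bot_iff, WithBot.coe_ne_bot, WithBot.bot_ne_coe,
      and_false]
  | coe a =>
    rw [WithBot.coe_le_coe] at hle
    rw [← WithBot.coe_add, WithBot.coe_le_coe, WithBot.coe_inj]
    omega

end

/-! ### Strong duality and the representation of the dec-min set -/

section

variable [DecidableEq S] [Nonempty S] {p : Finset S → WithBot ℤ} {m : S → ℤ}

/-- Strong duality. -/
theorem NoTightening.exists_dual (h : NoTightening p m) (hp : Supermodular p) (h0 : p ∅ = 0)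
    (hm : m ∈ integralBases p) :
    ∃ π : S → ℤ, ((∑ s, m s ^ 2 : ℤ) : WithBot ℤ) ≤ dualObjective p π := by
  obtain ⟨C, hanti, hT, hsub, hsup⟩ := h.exists_chain hp h0 hm
  -- Odd values 2m(s) ± 1 keep m(s) among the two roundings of π(s)/2; the sign is chosen so that {π
  -- ≥ 2β - 1} is exactly C(β).
  set π : S → ℤ := fun s => if s ∈ C (m s + 1) then 2 * m s + 1 else 2 * m s - 1 with hπ
  have hlevel : ∀ β u, u ∈ C β ↔ 2 * β - 1 ≤ π u := by
    intro β u
    simp only [hπ]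
    constructor
    · intro hu
      have h1 := hsup β u hu
      split_ifs with h2
      · omega
      · have : β ≠ m u + 1 := by rintro rfl; exact h2 hu
        omega
    · intro hu
      split_ifs at hu with h2
      · exact hanti (show β ≤ m u + 1 by omega) h2
      · exact hsub β u (by omega)
  refine ⟨π, (sum_sq_le_dualObjective_iff hm π).mpr ⟨fun s => ?_, ?_⟩⟩
  · rw [floor_half, ceil_half]
    simp only [hπ]
    split_ifs <;> omega
  · refine linearExtension_eq_of_tight hm π fun s => ?_
    obtain ⟨β, hβ⟩ : ∃ β, π s = 2 * β - 1 := by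
      simp only [hπ]
      split_ifs
      · exact ⟨m s + 1, by ring⟩
      · exact ⟨m s, rfl⟩
    convert hT β using 1
    ext u
    simp [hlevel, hβ]

theorem decMinElements_eq_halfBox_inter_minWeightElements (hp : Supermodular p) (h0 : p ∅ = 0)
    (huniv : p Finset.univ ≠ ⊥) {π : S → ℤ} (hπ : IsDualOptimal p π) :
    decMinElements (integralBases p) = halfBox π ∩ minWeightElements (integralBases p) π := by
  have hdual : ∀ m ∈ integralBases p, NoTightening p m →
      m ∈ halfBox π ∧ linearExtension p π = ((∑ s, π s * m s : ℤ) : WithBot ℤ) := by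
    intro m hm h
    obtain ⟨τ, hτ⟩ := h.exists_dual hp h0 hm
    exact (sum_sq_le_dualObjective_iff hm π).mp (hτ.trans (hπ τ))
  ext m
  constructor
  · intro hmd
    have hm := hmd.1
    obtain ⟨hbox, hlin⟩ := hdual m hm ((mem_decMinElements_iff_noTightening hp h0 hm).mp hmd)
    refine ⟨hbox, hm, fun z hz => ?_⟩
    have := linearExtension_le hz π
    rwa [hlin, WithBot.coe_le_coe] at this
  · rintro ⟨hbox, hm, hmin⟩
    -- A square-sum minimizer m₀ shows that the minimum π-weight equals p̂(π), so m also satisfies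
    -- both slackness conditions.
    obtain ⟨m₀, hm₀, hmin₀⟩ := exists_sum_sq_min hp h0 huniv
    obtain ⟨-, hlin⟩ := hdual m₀ hm₀ (noTightening_of_sum_sq_le hmin₀)
    have hle := linearExtension_le hm π
    rw [hlin, WithBot.coe_le_coe] at hle
    rw [le_antisymm hle (hmin m₀ hm₀)] at hlin
    have hsq := (sum_sq_le_dualObjective_iff hm π).mpr ⟨hbox, hlin⟩
    refine (mem_decMinElements_iff_noTightening hp h0 hm).mpr (noTightening_of_sum_sq_le ?_)
    exact fun y hy => WithBot.coe_le_coe.mp (hsq.trans (dualObjective_le hy π))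

end

/-! ### The matroidal structure of the set of dec-min elements -/

section

variable [DecidableEq S] {p : Finset S → WithBot ℤ}

theorem decMinElements_exchange (hp : Supermodular p) (h0 : p ∅ = 0) {m y : S → ℤ}
    (hm : m ∈ decMinElements (integralBases p)) (hy : y ∈ decMinElements (integralBases p))
    {t : S} (ht : y t < m t) :
    ∃ s, m s < y s ∧ shift m s t ∈ decMinElements (integralBases p) := by
  have hmB := hm.1
  have hyB := hy.1
  have hmN := (mem_decMinElements_iff_noTightening hp h0 hmB).mp hm
  have hyN := (mem_decMinElements_iff_noTightening hp h0 hyB).mp hy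
  obtain ⟨C, -, hT, hsub, hsup⟩ := hmN.exists_chain hp h0 hmB
  -- m and y have equal excess over m(t), so y has the same sum as m on C(m(t) + 1) and is split by
  -- it at m(t) as well.
  obtain ⟨hCeq, hge, hle⟩ := (hT (m t + 1)).eq_of_excess_le (β := m t)
    (fun s hs => by have := hsup _ s hs; omega)
    (fun s hs => by have := mt (hsub (m t + 1) s) hs; omega)
    hyB (hyN.excess_le hp h0 hyB hmB _)
  have htC : t ∉ C (m t + 1) := fun h => absurd (hge t h) (not_le.mpr ht)
  have hU := (Tight.inter_union hp (mem_integralBases.mp hmB).2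
    (tight_tightHull hp hmB t) (hT (m t + 1))).2
  have hUle : ∑ s ∈ tightHull p m t ∪ C (m t + 1), m s ≤
      ∑ s ∈ tightHull p m t ∪ C (m t + 1), y s := by
    have := (mem_integralBases.mp hyB).2 (tightHull p m t ∪ C (m t + 1))
    rwa [hU, WithBot.coe_le_coe] at this
  rw [← Finset.sdiff_union_self_eq_union, Finset.sum_union Finset.sdiff_disjoint,
    Finset.sum_union Finset.sdiff_disjoint, hCeq, add_le_add_iff_right] at hUle
  -- On hull(t) minus C the sum of y is at least that of m, yet y is smaller at t; some s there must
  -- compensate.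
  obtain ⟨s, hs, hlt⟩ : ∃ s ∈ tightHull p m t \ C (m t + 1), m s < y s := by
    by_contra hcon
    push Not at hcon
    exact absurd hUle (not_le.mpr (Finset.sum_lt_sum hcon
      ⟨t, Finset.mem_sdiff.mpr ⟨self_mem_tightHull t, htC⟩, ht⟩))
  rw [Finset.mem_sdiff] at hs
  have h1 := hmN.le_of_mem_tightHull hmB hs.1
  have h2 := hle s hs.2
  have hmem := shift_mem_integralBases hmB (mem_tightHull.mp hs.1)
  refine ⟨s, hlt, (mem_decMinElements_iff_noTightening hp h0 hmem).mpr fun a b hab hab' => ?_⟩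
  have hst : s ≠ t := by rintro rfl; omega
  -- Here m(t) - 1 ≤ m(s) < y(s) ≤ m(t), so m(s) = m(t) - 1 and the shift merely swaps two values.
  have hex : ∀ β, excess (shift m s t) β = excess m β := by
    intro β
    have := sum_comp_shift m hst (fun a => max (a - β) 0)
    rw [show m s + 1 = m t by omega, show m t - 1 = m s by omega] at this
    unfold excess
    rw [this]
    ring
  have hdm : shift m s t ∈ decMinElements (integralBases p) := ⟨hmem, fun z hz =>
    decSmaller_or_valueEquivalent_of_excess_le fun β =>
      (hex β).trans_le (hmN.excess_le hp h0 hmB hz β)⟩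
  exact (mem_decMinElements_iff_noTightening hp h0 hmem).mp hdm a b hab hab'

end

/-! ### From base exchange in a unit box to a matroid -/

open Classical in
/-- The vector `Δ + χ_X`. -/
noncomputable def addIndicator {S : Type*} (Δ : S → ℤ) (X : Set S) : S → ℤ :=
  fun s => Δ s + if s ∈ X then 1 else 0

theorem addIndicator_of_mem_box {S : Type*} {Δ m : S → ℤ} (h : ∀ s, m s = Δ s ∨ m s = Δ s + 1) :
    addIndicator Δ {s | m s = Δ s + 1} = m := by
  funext s
  unfold addIndicator
  rcases h s with h | h <;> simp [h]

theorem shift_addIndicator {S : Type*} [DecidableEq S] (Δ : S → ℤ) {X : Set S} {s t : S}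
    (hs : s ∉ X) (ht : t ∈ X) :
    shift (addIndicator Δ X) s t = addIndicator Δ (insert s (X \ {t})) := by
  have hst : s ≠ t := by rintro rfl; exact hs ht
  funext u
  unfold shift addIndicator
  by_cases h1 : u = s
  · subst h1; simp [hs, hst]
  · by_cases h2 : u = t
    · subst h2; simp [ht, h1]
    · have h3 : u ∈ insert s (X \ {t}) ↔ u ∈ X := by simp [h1, h2]
      simp only [h1, h2, if_false, add_zero, sub_zero]
      by_cases hu : u ∈ X
      · rw [if_pos hu, if_pos (h3.mpr hu)]
      · rw [if_neg hu, if_neg (mt h3.mp hu)]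

theorem sum_addIndicator_sub {S : Type*} (Δ : S → ℤ) (X : Set S) (Z : Finset S) :
    ∑ s ∈ Z, (addIndicator Δ X s - Δ s) = (((Z : Set S) ∩ X).ncard : ℤ) := by
  classical
  have : (Z : Set S) ∩ X = ((Z.filter (· ∈ X) : Finset S) : Set S) := by
    ext; simp
  rw [this, Set.ncard_coe_finset, Finset.card_filter]
  simp [addIndicator]

theorem ncard_le_toNat_eRk (M : Matroid S) {I Z : Set S} (hI : M.Indep I) (hIZ : I ⊆ Z) :
    I.ncard ≤ (M.eRk Z).toNat := by
  have h := hI.encard_le_eRk_of_subset hIZ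
  exact ENat.toNat_le_toNat h
    (ne_top_of_le_ne_top (Set.toFinite Z).encard_lt_top.ne (M.eRk_le_encard Z))

theorem toNat_eRk_mono (M : Matroid S) {X Y : Set S} (h : X ⊆ Y) :
    (M.eRk X).toNat ≤ (M.eRk Y).toNat :=
  ENat.toNat_le_toNat (M.eRk_mono h)
    (ne_top_of_le_ne_top (Set.toFinite Y).encard_lt_top.ne (M.eRk_le_encard Y))

theorem toNat_eRk_le_ncard (M : Matroid S) (X : Set S) : (M.eRk X).toNat ≤ X.ncard :=
  ENat.toNat_le_toNat (M.eRk_le_encard X) (Set.toFinite X).encard_lt_top.ne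

theorem indep_of_ncard_le_toNat_eRk (M : Matroid S) {X : Set S}
    (h : X.ncard ≤ (M.eRk X).toNat) : M.Indep X := by
  rw [M.indep_iff_eRk_eq_encard_of_finite (Set.toFinite X), ← (Set.toFinite X).cast_ncard_eq,
    ← le_antisymm (toNat_eRk_le_ncard M X) h, ENat.natCast_toNat]
  exact ne_top_of_le_ne_top (Set.toFinite X).encard_lt_top.ne (M.eRk_le_encard X)

theorem isBase_iff_ncard (M : Matroid S) (X : Set S) :
    M.IsBase X ↔ X.ncard = (M.eRk Set.univ).toNat ∧
      ∀ Z : Finset S, ((Z : Set S) ∩ X).ncard ≤ (M.eRk (Z : Set S)).toNat := by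
  constructor
  · intro h
    refine ⟨?_, fun Z => ncard_le_toNat_eRk M (h.indep.subset Set.inter_subset_right)
      Set.inter_subset_left⟩
    rw [M.eRk_univ_eq, ← h.encard_eq_eRank, Set.ncard]
  · rintro ⟨h1, h2⟩
    -- Testing the rank bound on X itself makes X independent; its size then makes it a base.
    have hX := h2 (Set.toFinite X).toFinset
    rw [Set.Finite.coe_toFinset, Set.inter_self] at hX
    have hI := indep_of_ncard_le_toNat_eRk M hX
    obtain ⟨B, hB, hXB⟩ := hI.exists_isBase_superset
    have hBc : B.ncard = X.ncard := by
      rw [h1, M.eRk_univ_eq, ← hB.encard_eq_eRank, Set.ncard]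
    rwa [Set.eq_of_subset_of_ncard_le hXB hBc.le]

theorem mem_integralMembers_translate (M : Matroid S) (Δ m : S → ℤ) :
    m ∈ integralMembers ((fun x s => x s + (Δ s : ℝ)) '' matroidBasePolyhedron M) ↔
      ∑ s, (m s - Δ s) = ((M.eRk Set.univ).toNat : ℤ) ∧
        ∀ Z : Finset S, ∑ s ∈ Z, (m s - Δ s) ≤ ((M.eRk (Z : Set S)).toNat : ℤ) := by
  have key : m ∈ integralMembers ((fun x s => x s + (Δ s : ℝ)) '' matroidBasePolyhedron M) ↔
      (fun s => ((m s - Δ s : ℤ) : ℝ)) ∈ matroidBasePolyhedron M := by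
    constructor
    · rintro ⟨x, hx, hxm⟩
      convert hx using 1
      funext s
      have := congrFun hxm s
      simp only at this
      push_cast
      linarith
    · intro h
      refine ⟨_, h, ?_⟩
      funext s
      push_cast
      ring
  rw [key, matroidBasePolyhedron, Set.mem_ofPred_eq]
  simp only [← Int.cast_sum, ← Int.cast_natCast (R := ℝ), Int.cast_inj, Int.cast_le]

/-- The upper bound is r({s}) ≤ 1; the lower one is x(s) ≥ r(S) - r(S - s) ≥ 0. -/
theorem mem_box_of_sum_le_rank (M : Matroid S) {x : S → ℤ}
    (h1 : ∑ s, x s = ((M.eRk Set.univ).toNat : ℤ))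
    (h2 : ∀ Z : Finset S, ∑ s ∈ Z, x s ≤ ((M.eRk (Z : Set S)).toNat : ℤ)) (s : S) :
    x s = 0 ∨ x s = 1 := by
  classical
  have hs := h2 {s}
  have hr := toNat_eRk_le_ncard M {s}
  have hc := h2 (Finset.univ.erase s)
  have hm := toNat_eRk_mono M (Set.subset_univ ((Finset.univ.erase s : Finset S) : Set S))
  have hsum := Finset.add_sum_erase Finset.univ x (Finset.mem_univ s)
  rw [Finset.sum_singleton, Finset.coe_singleton] at hs
  rw [Set.ncard_singleton] at hr
  omega

/-- A nonempty set of integral vectors in a unit box that satisfies the exchange property is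
matroidal M-convex. -/
theorem isMatroidalMConvex_of_exchange [DecidableEq S] {D : Set (S → ℤ)} (hne : D.Nonempty)
    (Δ : S → ℤ) (hbox : ∀ m ∈ D, ∀ s, m s = Δ s ∨ m s = Δ s + 1)
    (hex : ∀ m ∈ D, ∀ y ∈ D, ∀ t, y t < m t → ∃ s, m s < y s ∧ shift m s t ∈ D) :
    IsMatroidalMConvex D := by
  let M : Matroid S := Matroid.ofIsBaseOfFinite (E := Set.univ) Set.finite_univ
    (fun X => addIndicator Δ X ∈ D)
    (by
      obtain ⟨m, hm⟩ := hne
      exact ⟨{s | m s = Δ s + 1}, by rwa [addIndicator_of_mem_box (hbox m hm)]⟩)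
    (by
      intro X Y hX hY t ht
      obtain ⟨s, hs, hmem⟩ := hex _ hX _ hY t (by simp [addIndicator, ht.1, ht.2])
      have hsX : s ∉ X := fun h => by
        simp only [addIndicator, h, if_true] at hs
        split_ifs at hs <;> omega
      have hsY : s ∈ Y := by
        by_contra h
        simp [addIndicator, h, hsX] at hs
      refine ⟨s, ⟨hsY, hsX⟩, ?_⟩
      rwa [shift_addIndicator Δ hsX ht.1] at hmem)
    (fun _ _ => Set.subset_univ _)
  have hM : ∀ X, M.IsBase X ↔ addIndicator Δ X ∈ D := fun X => Iff.rfl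
  refine ⟨M, Δ, rfl, ?_⟩
  have hchar : ∀ X, addIndicator Δ X ∈ D ↔ addIndicator Δ X ∈
      integralMembers ((fun x s => x s + (Δ s : ℝ)) '' matroidBasePolyhedron M) := by
    intro X
    rw [← hM, isBase_iff_ncard M, mem_integralMembers_translate]
    simp only [sum_addIndicator_sub, Finset.coe_univ, Set.univ_inter]
    norm_cast
  -- Both sets lie in the box Δ + {0,1}^S, so comparing them on vectors Δ + χ_X suffices.
  ext m
  constructor
  · intro hm
    rwa [← addIndicator_of_mem_box (hbox m hm), ← hchar, addIndicator_of_mem_box (hbox m hm)]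
  · intro hm
    have hm' := (mem_integralMembers_translate M Δ m).mp hm
    have hb : ∀ s, m s = Δ s ∨ m s = Δ s + 1 := fun s => by
      have := mem_box_of_sum_le_rank M hm'.1 hm'.2 s
      omega
    rwa [← addIndicator_of_mem_box hb, hchar, addIndicator_of_mem_box hb]

theorem isMatroidalMConvex_decMinElements [DecidableEq S] [Nonempty S]
    {p : Finset S → WithBot ℤ} (hp : Supermodular p) (h0 : p ∅ = 0)
    (huniv : p Finset.univ ≠ ⊥) : IsMatroidalMConvex (decMinElements (integralBases p)) := by
  obtain ⟨m, hm, hmin⟩ := exists_sum_sq_min hp h0 huniv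
  have hN := noTightening_of_sum_sq_le hmin
  obtain ⟨π, hπ⟩ := hN.exists_dual hp h0 hm
  have hopt : IsDualOptimal p π := fun τ => (dualObjective_le hm τ).trans hπ
  -- A single dual optimum π confines all dec-min elements to the unit box based at ⌊π/2⌋.
  refine isMatroidalMConvex_of_exchange
    ⟨m, (mem_decMinElements_iff_noTightening hp h0 hm).mpr hN⟩ (fun s => π s / 2)
    (fun y hy s => ?_) fun y hy z hz t ht => decMinElements_exchange hp h0 hy hz ht
  rw [decMinElements_eq_halfBox_inter_minWeightElements hp h0 huniv hopt] at hy
  have := hy.1 s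
  rw [floor_half, ceil_half] at this
  omega

end DecMin

theorem mainTheorem9 {S : Type*} [Fintype S] [DecidableEq S] [Nonempty S]
    (p : Finset S → WithBot ℤ) (hp_empty : p ∅ = 0) (hp_univ : p Finset.univ ≠ ⊥)
    (hp : DecMin.Supermodular p) :
    (∀ π : S → ℤ, DecMin.IsDualOptimal p π →
      DecMin.decMinElements (DecMin.integralMembers (DecMin.basePolyhedron p)) =
        DecMin.halfBox π ∩
          DecMin.minWeightElements (DecMin.integralMembers (DecMin.basePolyhedron p)) π) ∧
    DecMin.IsMatroidalMConvex
      (DecMin.decMinElements (DecMin.integralMembers (DecMin.basePolyhedron p))) :=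
  ⟨fun _ hπ =>
    DecMin.decMinElements_eq_halfBox_inter_minWeightElements hp hp_empty hp_univ hπ,
    DecMin.isMatroidalMConvex_decMinElements hp hp_empty hp_univ⟩
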